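/- Fix a first-order signature $\Sigma$ (relation, function and constant symbols). Formulas of Paraconsistent Dependence Logic $\mathbf{PFO}(=\!(\cdot,\cdot))$ over $\Sigma$ are given by $$\psi ::= R\vec t \mid t_1=t_2 \mid\; =\!(\vec t_1,\vec t_2) \mid \lnot\psi \mid \psi\lor\psi \mid \exists v\,\psi,$$ where $\vec t_1,\vec t_2$ are finite (possibly empty) tuples of terms; $\psi\land\theta$ abbreviates $\lnot(\lnot\psi\lor\lnot\theta)$, $\forall v\,\psi$ abbreviates $\lnot\exists v\,\lnot\psi$, and a sentence is a formula without free variables. Models are ordinary first-order models with nonempty domain. A team $X$ over a model $M$ is a set of assignments into $M$ with a common domain. Put $X[F/v]=\{s[m/v] : s\in X,\ m\in F(s)\}$ for $F:X\to\mathcal P(\mathrm{Dom}(M))\setminus\{\emptyset\}$, and $X[M/v]=\{s[m/v] : s\in X,\ m\in \mathrm{Dom}(M)\}$. Positive and negative satisfaction are defined, for teams whose domain contains the free variables of the formula, by - $(M,X)\models^{+}\alpha$ (resp. $\models^{-}\alpha$), for $\alpha$ of the form $R\vec t$ or $t_1=t_2$, iff some $s\in X$ satisfies (resp. does not satisfy)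 $\alpha$ in $M$ in the usual sense; - $(M,X)\models^{+}\;=\!(\vec t_1,\vec t_2)$ iff any two $s,s'\in X$ that give the same value to $\vec t_1$ give the same value to $\vec t_2$; and $(M,X)\models^{-}\;=\!(\vec t_1,\vec t_2)$ iff $X\neq\emptyset$; - $(M,X)\models^{\pm}\lnot\psi$ iff $(M,X)\models^{\mp}\psi$; - $(M,X)\models^{+}\psi\lor\theta$ iff $(M,X)\models^{+}\psi$ or $(M,X)\models^{+}\theta$; and $(M,X)\models^{-}\psi\lor\theta$ iff for all $Y,Z$ with $X=Y\cup Z$, $(M,Y)\models^{-}\psi$ or $(M,Z)\models^{-}\theta$; - $(M,X)\models^{+}\exists v\,\psi$ iff $(M,X[M/v])\models^{+}\psi$; and $(M,X)\models^{-}\exists v\,\psi$ iff $(M,X[F/v])\models^{-}\psi$ for all $F:X\to\mathcal P(\mathrm{Dom}(M))\setminus\{\emptyset\}$. For a sentence $\phi$, write $M\models^{\pm}\phi$ ("$\phi$ is true / false in $M$") for $(M,\{\emptyset\})\models^{\pm}\phi$, where $\{\emptyset\}$ is the team that contains only the empty assignment. **Theorem.** For every sentence $\phi$ of $\mathbf{PFO}(=\!(\cdot,\cdot))$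 over $\Sigma$ there is a first-order sentence $\phi'$ over $\Sigma$ that is positively logically equivalent to $\phi$: for all models $M$ over $\Sigma$, $$M\models^{+}\phi \iff M\models\phi' .$$ The equivalence need not extend to falsity: there is a sentence $\phi$ of $\mathbf{PFO}(=\!(\cdot,\cdot))$ over $\Sigma$ such that no first-order sentence $\phi'$ over $\Sigma$ satisfies, for all models $M$, both $M\models^{+}\phi\iff M\models\phi'$ and $M\models^{-}\phi\iff M\not\models\phi'$. -/

import Mathlib

universe u v w

namespace ParaTeam

/-- The two directions of satisfaction in team semantics: truth and falsity. -/
inductive Sign : Type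
  | pos
  | neg

/-- `PForm L V`: formulas of first-order logic with functional dependence atoms over the signature
`L`, all of whose free variables belong to the finite set `V` of variables (variables are natural
numbers). Conjunction and universal quantification are abbreviations, see `PForm.and`,
`PForm.all`. -/
inductive PForm (L : FirstOrder.Language) : Finset ℕ → Type _
  /-- `R t` -/
  | rel {V : Finset ℕ} {n : ℕ} (R : L.Relations n) (t : Fin n → L.Term V) : PForm L V
  /-- `t₁ = t₂` -/
  | eq {V : Finset ℕ} (t₁ t₂ : L.Term V) : PForm L V
  /-- The dependence atom `=(t₁, t₂)` for finite, possibly empty, tuples of terms `t₁`, `t₂`. -/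
  | dep {V : Finset ℕ} {m n : ℕ} (t₁ : Fin m → L.Term V) (t₂ : Fin n → L.Term V) : PForm L V
  /-- `¬ ψ` -/
  | neg {V : Finset ℕ} (ψ : PForm L V) : PForm L V
  /-- `ψ ∨ θ` -/
  | or {V : Finset ℕ} (ψ θ : PForm L V) : PForm L V
  /-- `∃ v ψ` -/
  | ex {V : Finset ℕ} (v : ℕ) (ψ : PForm L (insert v V)) : PForm L V

/-- A sentence is a formula without free variables. -/
abbrev PSentence (L : FirstOrder.Language) : Type _ := PForm L ∅

/-- `ψ ∧ θ` abbreviates `¬ (¬ ψ ∨ ¬ θ)`. -/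
def PForm.and {L : FirstOrder.Language} {V : Finset ℕ} (ψ θ : PForm L V) : PForm L V :=
  .neg (.or (.neg ψ) (.neg θ))

/-- `∀ v ψ` abbreviates `¬ ∃ v ¬ ψ`. -/
def PForm.all {L : FirstOrder.Language} {V : Finset ℕ} (v : ℕ) (ψ : PForm L (insert v V)) :
    PForm L V :=
  .neg (.ex v (.neg ψ))

/-- An assignment over `M` with domain `V`. -/
abbrev Assignment (M : Type*) (V : Finset ℕ) : Type _ := V → M

/-- A team over `M` with domain `V`: a set of assignments with domain `V`. -/
abbrev Team (M : Type*) (V : Finset ℕ) : Type _ := Set (Assignment M V)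

/-- `s[m/v]`, an assignment with domain `V ∪ {v}`. -/
def Assignment.update {M : Type*} {V : Finset ℕ} (s : Assignment M V) (v : ℕ) (m : M) :
    Assignment M (insert v V) :=
  fun w => if h : w.1 = v then m else s ⟨w.1, Finset.mem_of_mem_insert_of_ne w.2 h⟩

/-- `X[F/v] = {s[m/v] : s ∈ X, m ∈ F(s)}`. Only the values of `F` on `X` matter. -/
def Team.supplement {M : Type*} {V : Finset ℕ} (X : Team M V) (F : Assignment M V → Set M)
    (v : ℕ) : Team M (insert v V) :=
  {s' | ∃ s ∈ X, ∃ m ∈ F s, s' = s.update v m}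

/-- `X[M/v] = {s[m/v] : s ∈ X, m ∈ M}`. -/
def Team.duplicate {M : Type*} {V : Finset ℕ} (X : Team M V) (v : ℕ) : Team M (insert v V) :=
  {s' | ∃ s ∈ X, ∃ m : M, s' = s.update v m}

/-- Paraconsistent team semantics with ordinary dependence atoms: `Sat φ d X` says that the team
`X` over the model `M` satisfies `φ` positively (`d = pos`) or negatively (`d = neg`). -/
def Sat {L : FirstOrder.Language} {M : Type*} [L.Structure M] :
    {V : Finset ℕ} → PForm L V → Sign → Team M V → Prop
  | _, .rel R t, .pos, X =>
      ∃ s ∈ X, FirstOrder.Language.Structure.RelMap R (fun i => (t i).realize s)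
  | _, .rel R t, .neg, X =>
      ∃ s ∈ X, ¬ FirstOrder.Language.Structure.RelMap R (fun i => (t i).realize s)
  | _, .eq t₁ t₂, .pos, X => ∃ s ∈ X, t₁.realize s = t₂.realize s
  | _, .eq t₁ t₂, .neg, X => ∃ s ∈ X, t₁.realize s ≠ t₂.realize s
  | _, .dep t₁ t₂, .pos, X =>
      ∀ s ∈ X, ∀ s' ∈ X, (∀ i, (t₁ i).realize s = (t₁ i).realize s') →
        ∀ j, (t₂ j).realize s = (t₂ j).realize s'
  | _, .dep _ _, .neg, X => X.Nonempty
  | _, .neg ψ, .pos, X => Sat ψ .neg X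
  | _, .neg ψ, .neg, X => Sat ψ .pos X
  | _, .or ψ θ, .pos, X => Sat ψ .pos X ∨ Sat θ .pos X
  | V, .or ψ θ, .neg, X => ∀ Y Z : Team M V, X = Y ∪ Z → Sat ψ .neg Y ∨ Sat θ .neg Z
  | _, .ex v ψ, .pos, X => Sat ψ .pos (X.duplicate v)
  | V, .ex v ψ, .neg, X =>
      ∀ F : Assignment M V → Set M, (∀ s ∈ X, (F s).Nonempty) → Sat ψ .neg (X.supplement F v)

/-- The team `{∅}` whose only element is the empty assignment. -/
def emptyAssignmentTeam (M : Type*) : Team M ∅ :=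
  {fun v => absurd v.2 (Finset.notMem_empty v.1)}

/-- The sentence `φ` is paraconsistently true in `M`. -/
def IsTrue {L : FirstOrder.Language} (M : Type*) [L.Structure M] (φ : PSentence L) : Prop :=
  Sat φ .pos (emptyAssignmentTeam M)

/-- The sentence `φ` is paraconsistently false in `M`. -/
def IsFalse {L : FirstOrder.Language} (M : Type*) [L.Structure M] (φ : PSentence L) : Prop :=
  Sat φ .neg (emptyAssignmentTeam M)

end ParaTeam

namespace ParaTeam

open FirstOrder FirstOrder.Language

variable {L : FirstOrder.Language.{u, v}}

/-! Failure is easier to describe than satisfaction: the universal quantifiers over splittings and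
choice functions in the negative clauses become existential. Failure of any formula, in either
direction, says that the team contains finitely many assignments jointly satisfying a first-order
`χ` and that all its members satisfy a first-order `f`. Induction on formulas proves this
(`hasNormalForm`). On the team `{∅}` the condition is a first-order sentence, whose negation
expresses truth. Falsity is not captured because `exConst` is both true and false in a one-element
model. -/

/-- The set of teams that fail `φ` in direction `d` has a first-order normal form: `X` fails `φ` iff
`X` contains a finite family of assignments satisfying `χ`, indexed by `ι`, and all the elements
of `X` satisfy `f`. -/
def HasNormalForm {V : Finset ℕ} (φ : PForm L V) (d : Sign) : Prop :=
  ∃ (ι : Type) (_ : Finite ι) (χ : L.Formula (ι × V)) (f : L.Formula V),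
    ∀ (M : Type w) [L.Structure M] (X : Team M V),
      ¬ Sat φ d X ↔
        (∃ S : ι → Assignment M V, (∀ i, S i ∈ X) ∧ χ.Realize fun p => S p.1 p.2) ∧
          ∀ s ∈ X, f.Realize s

/-- Separate the variable `v` from the variables in `V`. -/
def splitVar (v : ℕ) (V : Finset ℕ) (w : ↥(insert v V)) : V ⊕ Unit :=
  if h : w.1 = v then .inr () else .inl ⟨w.1, Finset.mem_of_mem_insert_of_ne w.2 h⟩

lemma elim_splitVar {M : Type*} {V : Finset ℕ} (s : Assignment M V) (v : ℕ) (m : M) :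
    Sum.elim s (fun _ => m) ∘ splitVar v V = s.update v m := by
  funext w
  by_cases h : w.1 = v <;> simp [splitVar, Assignment.update, h]

/-- Separate the copies of the variable `v` from the copies of the variables in `V`. -/
def splitVars (ι : Type) (v : ℕ) (V : Finset ℕ) (p : ι × ↥(insert v V)) : (ι × V) ⊕ ι :=
  (splitVar v V p.2).elim (fun w => .inl (p.1, w)) fun _ => .inr p.1

lemma elim_splitVars {M : Type*} {ι : Type} {V : Finset ℕ} (S : ι → Assignment M V) (v : ℕ)
    (m : ι → M) :
    Sum.elim (fun p : ι × V => S p.1 p.2) m ∘ splitVars ι v V =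
      fun p => (S p.1).update v (m p.1) p.2 := by
  funext p
  by_cases h : p.2.1 = v <;> simp [splitVars, splitVar, Assignment.update, h]

lemma hasNormalForm_of_flat {V : Finset ℕ} {φ : PForm L V} {d : Sign} (f : L.Formula V)
    (h : ∀ (M : Type w) [L.Structure M] (X : Team M V),
      ¬ Sat φ d X ↔ ∀ s ∈ X, f.Realize s) :
    HasNormalForm.{u, v, w} φ d := by
  refine ⟨Empty, inferInstance, ⊤, f, fun M _ X => ?_⟩
  simp [h M X]

lemma hasNormalForm_dep_pos {V : Finset ℕ} {m n : ℕ} (t₁ : Fin m → L.Term V)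
    (t₂ : Fin n → L.Term V) : HasNormalForm.{u, v, w} (.dep t₁ t₂) .pos := by
  let agree (t : L.Term V) : L.Formula (Bool × V) :=
    (t.relabel (Prod.mk false)).equal (t.relabel (Prod.mk true))
  refine ⟨Bool, inferInstance,
    Formula.iInf (fun i => agree (t₁ i)) ⊓ ∼(Formula.iInf fun j => agree (t₂ j)), ⊤,
    fun M _ X => ?_⟩
  have key (S : Bool → Assignment M V) (t : L.Term V) :
      (agree t).Realize (fun p => S p.1 p.2) ↔ t.realize (S false) = t.realize (S true) := by
    simp only [agree, Formula.realize_equal, Term.realize_relabel]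
    rfl
  simp only [Sat, Formula.realize_inf, Formula.realize_not, Formula.realize_iInf, key,
    Formula.realize_top, implies_true, and_true]
  push Not
  constructor
  · rintro ⟨s, hs, s', hs', h₁, h₂⟩
    exact ⟨fun b => bif b then s' else s, fun b => by cases b <;> simpa, h₁, h₂⟩
  · rintro ⟨S, hS, h₁, h₂⟩
    exact ⟨S false, hS _, S true, hS _, h₁, h₂⟩

lemma HasNormalForm.or_pos {V : Finset ℕ} {ψ θ : PForm L V}
    (hψ : HasNormalForm.{u, v, w} ψ .pos) (hθ : HasNormalForm.{u, v, w} θ .pos) :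
    HasNormalForm.{u, v, w} (.or ψ θ) .pos := by
  obtain ⟨ι, _, χ, f, h⟩ := hψ
  obtain ⟨κ, _, ξ, g, k⟩ := hθ
  refine ⟨ι ⊕ κ, inferInstance,
    χ.relabel (Prod.map .inl id) ⊓ ξ.relabel (Prod.map .inr id), f ⊓ g, fun M _ X => ?_⟩
  simp only [Sat, not_or, h, k, Formula.realize_inf, Formula.realize_relabel]
  constructor
  · rintro ⟨⟨⟨S, hS, hχ⟩, hf⟩, ⟨T, hT, hξ⟩, hg⟩
    exact ⟨⟨Sum.elim S T, by rintro (i | j) <;> simp [hS, hT], hχ, hξ⟩,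
      fun s hs => ⟨hf s hs, hg s hs⟩⟩
  · rintro ⟨⟨S, hS, hχ, hξ⟩, hfg⟩
    exact ⟨⟨⟨S ∘ .inl, fun _ => hS _, hχ⟩, fun s hs => (hfg s hs).1⟩,
      ⟨S ∘ .inr, fun _ => hS _, hξ⟩, fun s hs => (hfg s hs).2⟩

/-- The flat conditions `f` and `g` allow a largest choice for each half of the splitting. The
witnesses for a half must lie in it, so `f` or `g` is also imposed on them. -/
lemma HasNormalForm.or_neg {V : Finset ℕ} {ψ θ : PForm L V}
    (hψ : HasNormalForm.{u, v, w} ψ .neg) (hθ : HasNormalForm.{u, v, w} θ .neg) :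
    HasNormalForm.{u, v, w} (.or ψ θ) .neg := by
  obtain ⟨ι, _, χ, f, h⟩ := hψ
  obtain ⟨κ, _, ξ, g, k⟩ := hθ
  refine ⟨ι ⊕ κ, inferInstance,
    (χ.relabel (Prod.map .inl id) ⊓ Formula.iInf fun i => f.relabel (Prod.mk (.inl i))) ⊓
      (ξ.relabel (Prod.map .inr id) ⊓ Formula.iInf fun j => g.relabel (Prod.mk (.inr j))),
    f ⊔ g, fun M _ X => ?_⟩
  simp only [Sat, not_forall, not_or, h, k, Formula.realize_inf, Formula.realize_sup,
    Formula.realize_iInf, Formula.realize_relabel, exists_prop]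
  constructor
  · rintro ⟨Y, Z, rfl, ⟨⟨S, hS, hχ⟩, hf⟩, ⟨T, hT, hξ⟩, hg⟩
    exact ⟨⟨Sum.elim S T, by rintro (i | j) <;> simp [hS, hT],
      ⟨hχ, fun i => hf _ (hS i)⟩, hξ, fun j => hg _ (hT j)⟩,
      fun s hs => hs.imp (hf s) (hg s)⟩
  · rintro ⟨⟨S, hS, ⟨hχ, hf⟩, hξ, hg⟩, hfg⟩
    refine ⟨{s ∈ X | f.Realize s}, {s ∈ X | g.Realize s}, ?_,
      ⟨⟨S ∘ .inl, fun i => ⟨hS _, hf i⟩, hχ⟩, fun s hs => hs.2⟩,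
      ⟨S ∘ .inr, fun j => ⟨hS _, hg j⟩, hξ⟩, fun s hs => hs.2⟩
    ext s
    have := hfg s
    simp only [Set.mem_union, Set.mem_ofPred_eq]
    tauto

lemma HasNormalForm.ex_pos {V : Finset ℕ} {v : ℕ} {ψ : PForm L (insert v V)}
    (hψ : HasNormalForm.{u, v, w} ψ .pos) : HasNormalForm.{u, v, w} (.ex v ψ) .pos := by
  obtain ⟨ι, _, χ, f, h⟩ := hψ
  refine ⟨ι, inferInstance, Formula.iExs ι (χ.relabel (splitVars ι v V)),
    Formula.iAlls Unit (f.relabel (splitVar v V)), fun M _ X => ?_⟩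
  simp only [Sat, h, Formula.realize_iExs, Formula.realize_iAlls, Formula.realize_relabel,
    elim_splitVars]
  constructor
  · rintro ⟨⟨S, hS, hχ⟩, hf⟩
    choose T hT m hm using hS
    -- Each witness in the duplicated team is a member of `X` together with a value for `v`; these
    -- values become the variables bound by `iExs`.
    obtain rfl : S = fun i => (T i).update v (m i) := funext hm
    refine ⟨⟨T, hT, m, hχ⟩, fun s hs n => ?_⟩
    rw [show n = fun _ => n () from rfl, elim_splitVar]
    exact hf _ ⟨s, hs, _, rfl⟩
  · rintro ⟨⟨S, hS, m, hχ⟩, hf⟩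
    refine ⟨⟨fun i => (S i).update v (m i), fun i => ⟨S i, hS i, m i, rfl⟩, hχ⟩, ?_⟩
    rintro _ ⟨s, hs, n, rfl⟩
    simpa only [elim_splitVar] using hf s hs fun _ => n

/-- The largest admissible choice function sends `s` to all values `n` for which `s[n/v]` satisfies
`f`. It is nonempty-valued on `X` exactly when every member of `X` satisfies `∃ v, f`. -/
lemma HasNormalForm.ex_neg {V : Finset ℕ} {v : ℕ} {ψ : PForm L (insert v V)}
    (hψ : HasNormalForm.{u, v, w} ψ .neg) : HasNormalForm.{u, v, w} (.ex v ψ) .neg := by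
  obtain ⟨ι, _, χ, f, h⟩ := hψ
  refine ⟨ι, inferInstance,
    Formula.iExs ι ((χ ⊓ Formula.iInf fun i => f.relabel (Prod.mk i)).relabel (splitVars ι v V)),
    Formula.iExs Unit (f.relabel (splitVar v V)), fun M _ X => ?_⟩
  simp only [Sat, not_forall, h, Formula.realize_iExs, Formula.realize_relabel,
    elim_splitVars, Formula.realize_inf, Formula.realize_iInf, exists_prop]
  constructor
  · rintro ⟨F, hF, ⟨S, hS, hχ⟩, hf⟩
    choose T hT m hmF hm using id hS
    obtain rfl : S = fun i => (T i).update v (m i) := funext hm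
    refine ⟨⟨T, hT, m, hχ, fun i => hf _ (hS i)⟩, fun s hs => ?_⟩
    obtain ⟨n, hn⟩ := hF s hs
    refine ⟨fun _ => n, ?_⟩
    rw [elim_splitVar]
    exact hf _ ⟨s, hs, n, hn, rfl⟩
  · rintro ⟨⟨S, hS, m, hχ, hfm⟩, hf⟩
    refine ⟨fun s => {n | f.Realize (s.update v n)}, fun s hs => ?_,
      ⟨fun i => (S i).update v (m i), fun i => ⟨S i, hS i, m i, hfm i, rfl⟩, hχ⟩, ?_⟩
    · obtain ⟨n, hn⟩ := hf s hs
      rw [show n = fun _ => n () from rfl, elim_splitVar] at hn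
      exact ⟨_, hn⟩
    · rintro _ ⟨s, -, n, hn, rfl⟩
      exact hn

theorem hasNormalForm {V : Finset ℕ} (φ : PForm L V) :
    HasNormalForm.{u, v, w} φ .pos ∧ HasNormalForm.{u, v, w} φ .neg := by
  induction φ with
  | rel R t =>
    exact ⟨hasNormalForm_of_flat (∼(R.formula t)) fun M _ X => by simp [Sat, Formula.realize_rel],
      hasNormalForm_of_flat (R.formula t) fun M _ X => by simp [Sat, Formula.realize_rel]⟩
  | eq t₁ t₂ =>
    exact ⟨hasNormalForm_of_flat (∼(t₁.equal t₂)) fun M _ X => by simp [Sat],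
      hasNormalForm_of_flat (t₁.equal t₂) fun M _ X => by simp [Sat]⟩
  | dep t₁ t₂ =>
    -- Negative failure means that the team is empty: all its members satisfy `⊥`.
    exact ⟨hasNormalForm_dep_pos t₁ t₂, hasNormalForm_of_flat ⊥ fun M _ X => by
      simp [Sat, Set.Nonempty]⟩
  | neg ψ ih =>
    obtain ⟨⟨ι, hι, χ, f, h⟩, κ, hκ, ξ, g, k⟩ := ih
    exact ⟨⟨κ, hκ, ξ, g, fun M _ X => by simpa only [Sat] using k M X⟩,
      ⟨ι, hι, χ, f, fun M _ X => by simpa only [Sat] using h M X⟩⟩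
  | or ψ θ ihψ ihθ => exact ⟨ihψ.1.or_pos ihθ.1, ihψ.2.or_neg ihθ.2⟩
  | ex v ψ ih => exact ⟨ih.1.ex_pos, ih.2.ex_neg⟩

theorem exists_sentence_isTrue_iff (φ : PSentence L) :
    ∃ φ' : L.Sentence, ∀ (M : Type w) [L.Structure M], IsTrue M φ ↔ Sentence.Realize M φ' := by
  obtain ⟨ι, _, χ, f, h⟩ := (hasNormalForm.{u, v, w} φ).1
  refine ⟨∼(χ.relabel (fun p => isEmptyElim p.2) ⊓ f.relabel isEmptyElim), fun M _ => ?_⟩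
  have e {α : Type} [IsEmpty α] (g : L.Formula α) {a b : α → M} (h : g.Realize a) :
      g.Realize b := Subsingleton.elim a b ▸ h
  rw [IsTrue, ← not_iff_not, h, Sentence.Realize, Formula.realize_not, not_not,
    Formula.realize_inf, Formula.realize_relabel, Formula.realize_relabel]
  refine and_congr ?_ ?_
  · constructor
    · rintro ⟨S, -, hχ⟩
      exact e χ hχ
    · exact fun hχ => ⟨fun _ => isEmptyElim, fun _ => Subsingleton.elim _ _, e χ hχ⟩
  · constructor
    · exact fun hf => e f (hf _ rfl)
    · exact fun hf s _ => e f hf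

/-- `∃ x =(x)`: true exactly in the models with a single element, and false in every model. -/
def exConst (L : FirstOrder.Language.{u, v}) : PSentence L :=
  .ex 0 (.dep (m := 0) (n := 1) Fin.elim0 fun _ => Term.var ⟨0, Finset.mem_insert_self 0 ∅⟩)

lemma isTrue_exConst (M : Type w) [L.Structure M] : IsTrue M (exConst L) ↔ Subsingleton M := by
  simp only [IsTrue, exConst, Sat]
  constructor
  · refine fun h => ⟨fun a b => ?_⟩
    exact h _ ⟨_, rfl, a, rfl⟩ _ ⟨_, rfl, b, rfl⟩ (fun i => i.elim0) 0
  · exact fun _ _ _ _ _ _ _ => Subsingleton.elim _ _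

lemma isFalse_exConst (M : Type w) [L.Structure M] : IsFalse M (exConst L) := by
  simp only [IsFalse, exConst, Sat]
  intro F hF
  obtain ⟨m, hm⟩ := hF _ rfl
  exact ⟨_, _, rfl, m, hm, rfl⟩

end ParaTeam

theorem mainTheorem7 (L : FirstOrder.Language.{u, v}) :
    (∀ φ : ParaTeam.PSentence L, ∃ φ' : L.Sentence,
      ∀ (M : Type w) [L.Structure M] [Nonempty M],
        ParaTeam.IsTrue M φ ↔ FirstOrder.Language.Sentence.Realize M φ') ∧
    (∃ φ : ParaTeam.PSentence L, ¬ ∃ φ' : L.Sentence,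
      (∀ (M : Type w) [L.Structure M] [Nonempty M],
        ParaTeam.IsTrue M φ ↔ FirstOrder.Language.Sentence.Realize M φ') ∧
      (∀ (M : Type w) [L.Structure M] [Nonempty M],
        ParaTeam.IsFalse M φ ↔ ¬ FirstOrder.Language.Sentence.Realize M φ')) := by
  refine ⟨fun φ => ?_, ParaTeam.exConst L, ?_⟩
  · obtain ⟨φ', h⟩ := ParaTeam.exists_sentence_isTrue_iff.{u, v, w} φ
    exact ⟨φ', fun M _ _ => h M⟩
  · rintro ⟨φ', hpos, hneg⟩
    let _ : L.Structure PUnit.{w + 1} := ⟨fun _ _ => ⟨⟩, fun _ _ => False⟩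
    exact (hneg PUnit).1 (ParaTeam.isFalse_exConst _)
      ((hpos PUnit).1 ((ParaTeam.isTrue_exConst _).2 inferInstance))
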